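/- Let $G$ be a finite simple graph, let $B$ be a set of vertices that are initially blue (all other vertices are white), and let $L$ be a set of vertices called leaks. A blue vertex that is not a leak and has exactly one white neighbor may force that neighbor to become blue. For $\ell\ge 0$, the set $B$ is an $\ell$-leaky forcing set if, for every set $L$ of at most $\ell$ leaks (chosen after $B$), iterating this rule turns every vertex of $G$ blue. (If $G$ has at least $\ell$ vertices, this is the same as requiring it for every $L$ with exactly $\ell$ elements.) The $\ell$-leaky forcing number $Z_\ell(G)$ is the minimum size of an $\ell$-leaky forcing set of $G$. For $n\ge 1$ let the supertriangle $T_n$ be the equilateral triangular grid with $n$ vertices on each side: its vertices are the triples $(a,b,c)$ of nonnegative integers with $a+b+c=n-1$, and two vertices are adjacent if and only if one is obtained from the other by increasing one coordinate by $1$ and decreasing another coordinate by $1$. Its three sides are the sets of vertices given by $a=0$, $b=0$ and $c=0$ respectively. **Theorem 4.3.** For every $n\ge 1$: 1. $Z_0(T_n)=Z_1(T_n)=n$; 2. $Z_2(T_n)\le Z_3(T_n)\le 2n-1$; 3. if $n\ge 2$, then $Z_4(T_n)=Z_5(T_n)=3n-3$. Moreover, each side of $T_n$ has $n$ vertices and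 is a $1$-leaky forcing set; the union of any two distinct sides has $2n-1$ vertices and is a $3$-leaky forcing set; and, if $n\ge 2$, the union of all three sides has $3n-3$ vertices and is a $5$-leaky forcing set. -/

import Mathlib

/-- `LeakyBlue G L B v`: the vertex `v` eventually becomes blue in `G` when the vertices of `B` are
initially blue, the vertices of `L` are leaks, and the zero forcing color change rule is applied
exhaustively: a blue vertex `u` that is not a leak forces its neighbor `w` as soon as all the other
neighbors of `u` are blue. -/
inductive LeakyBlue {V : Type*} (G : SimpleGraph V) (L B : Finset V) : V → Prop
  | init {v : V} : v ∈ B → LeakyBlue G L B v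
  | force {u w : V} : u ∉ L → G.Adj u w → LeakyBlue G L B u →
      (∀ x, G.Adj u x → x ≠ w → LeakyBlue G L B x) → LeakyBlue G L B w

/-- `B` is an `ℓ`-leaky forcing set of `G`: for every choice of at most `ℓ` leaks (made after `B`),
every vertex of `G` becomes blue. When `G` has at least `ℓ` vertices this is the same as allowing
exactly `ℓ` leaks (`isLeakyForcingSet_iff_card_eq`); when `G` has fewer than `ℓ` vertices, all of
them may be leaks. -/
def IsLeakyForcingSet {V : Type*} (G : SimpleGraph V) (ℓ : ℕ) (B : Finset V) : Prop :=
  ∀ L : Finset V, L.card ≤ ℓ → ∀ v, LeakyBlue G L B v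

/-- The `ℓ`-leaky forcing number of a finite graph: the least size of an `ℓ`-leaky forcing set
(the set of all vertices is always one). -/
noncomputable def leakyForcingNumber {V : Type*} [Fintype V] (G : SimpleGraph V) (ℓ : ℕ) : ℕ :=
  sInf {k : ℕ | ∃ B : Finset V, B.card = k ∧ IsLeakyForcingSet G ℓ B}

/-- More leaks give fewer blue vertices. -/
theorem LeakyBlue.anti_leaks {V : Type*} {G : SimpleGraph V} {L L' B : Finset V} (h : L ⊆ L')
    {v : V} (hv : LeakyBlue G L' B v) : LeakyBlue G L B v := by
  induction hv with
  | init hB => exact LeakyBlue.init hB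
  | force hu ha _ _ ih1 ih2 => exact LeakyBlue.force (fun hL => hu (h hL)) ha ih1 ih2

/-- If the graph has at least `ℓ` vertices, it does not matter whether exactly `ℓ` or at most `ℓ`
leaks are chosen. -/
theorem isLeakyForcingSet_iff_card_eq {V : Type*} [Fintype V] (G : SimpleGraph V) (ℓ : ℕ)
    (hℓ : ℓ ≤ Fintype.card V) (B : Finset V) :
    IsLeakyForcingSet G ℓ B ↔ ∀ L : Finset V, L.card = ℓ → ∀ v, LeakyBlue G L B v := by
  constructor
  · intro h L hL
    exact h L hL.le
  · intro h L hL v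
    obtain ⟨L', hLL', hL'⟩ := Finset.exists_superset_card_eq hL hℓ
    exact (h L' hL' v).anti_leaks hLL'

/-- The vertices of the equilateral triangular grid with `n` vertices on each side: a vertex is
given by its three barycentric coordinates, which sum to `n - 1`. The coordinate `v.1 i` is the
index of the line parallel to the `i`-th side through `v`, counted from that side starting at `0`. -/
abbrev SupertriangleVertex (n : ℕ) : Type :=
  {v : Fin 3 → Fin n // (v 0 : ℕ) + (v 1 : ℕ) + (v 2 : ℕ) + 1 = n}

/-- The supertriangle `T_n`. Two distinct points are neighbors in the triangular grid when each
barycentric coordinate changes by at most one; as the coordinate sum is constant, this means that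
one coordinate goes up by one, another goes down by one, and the third stays the same. -/
def supertriangle (n : ℕ) : SimpleGraph (SupertriangleVertex n) where
  Adj v w := v ≠ w ∧ ∀ i : Fin 3, (v.1 i : ℕ) ≤ (w.1 i : ℕ) + 1 ∧ (w.1 i : ℕ) ≤ (v.1 i : ℕ) + 1
  symm := ⟨fun _ _ h => ⟨h.1.symm, fun i => ⟨(h.2 i).2, (h.2 i).1⟩⟩⟩
  loopless := ⟨fun _ h => h.1 rfl⟩

/-- The `i`-th of the three sides of the supertriangle. -/
def supertriangleSide (n : ℕ) (i : Fin 3) : Finset (SupertriangleVertex n) :=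
  Finset.univ.filter fun v => (v.1 i : ℕ) = 0

/-! Upper bounds: let `W` be the set of vertices that stay white. Each fully blue side yields two
blue vertices that have exactly one neighbor in `W` (`exists_extremalStep`), and those coming from
`s` sides are `2 * s` distinct vertices (`IsExtremalStep.eq_and_eq`). All of them must be leaks, so
fewer than `2 * s` leaks leave no white vertex.

Lower bound `n`: forcing propagates the vanishing of a function whose sum over every upward unit
triangle is zero. There are `n` fewer such triangles than vertices, so a dimension count gives `n ≤
B.card`. Lower bound `3 * n - 3`: boundary vertices have degree at most four, and if all neighbors
of a vertex leak, nothing can force it. -/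

theorem IsLeakyForcingSet.anti {V : Type*} {G : SimpleGraph V} {ℓ ℓ' : ℕ} (h : ℓ ≤ ℓ')
    {B : Finset V} (hB : IsLeakyForcingSet G ℓ' B) : IsLeakyForcingSet G ℓ B :=
  fun L hL => hB L (hL.trans h)

theorem leakyForcingNumber_le_card {V : Type*} [Fintype V] {G : SimpleGraph V} {ℓ : ℕ}
    {B : Finset V} (hB : IsLeakyForcingSet G ℓ B) : leakyForcingNumber G ℓ ≤ B.card :=
  Nat.sInf_le ⟨B, rfl, hB⟩

theorem le_leakyForcingNumber {V : Type*} [Fintype V] {G : SimpleGraph V} {ℓ k : ℕ}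
    (h : ∀ B : Finset V, IsLeakyForcingSet G ℓ B → k ≤ B.card) : k ≤ leakyForcingNumber G ℓ := by
  refine le_csInf ⟨_, Finset.univ, rfl, fun L _ v => .init (Finset.mem_univ v)⟩ ?_
  rintro _ ⟨B, rfl, hB⟩
  exact h B hB

theorem leakyForcingNumber_mono {V : Type*} [Fintype V] (G : SimpleGraph V) {ℓ ℓ' : ℕ}
    (h : ℓ ≤ ℓ') : leakyForcingNumber G ℓ ≤ leakyForcingNumber G ℓ' :=
  le_leakyForcingNumber fun _ hB => leakyForcingNumber_le_card (hB.anti h)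

/-- A vertex all of whose neighbors may be leaks lies in every leaky forcing set. -/
theorem IsLeakyForcingSet.mem_of_card_le {V : Type*} {G : SimpleGraph V} {ℓ : ℕ} {B : Finset V}
    (hB : IsLeakyForcingSet G ℓ B) {v : V} (N : Finset V) (hN : ∀ w, G.Adj v w → w ∈ N)
    (hcard : N.card ≤ ℓ) : v ∈ B := by
  cases hB N hcard v with
  | init h => exact h
  | force hu ha _ _ => exact absurd (hN _ ha.symm) hu

/-! ### Barycentric coordinates, indexed cyclically as `i`, `i + 1`, `i + 2` to treat all sides
alike -/

namespace SupertriangleVertex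

variable {n : ℕ}

theorem sum_eq (v : SupertriangleVertex n) (i : Fin 3) :
    (v.1 i : ℕ) + (v.1 (i + 1) : ℕ) + (v.1 (i + 2) : ℕ) + 1 = n := by
  have h := v.2
  fin_cases i <;> simp at h ⊢ <;> omega

theorem forall_coord_iff (P : Fin 3 → Prop) (i : Fin 3) :
    (∀ m, P m) ↔ P i ∧ P (i + 1) ∧ P (i + 2) := by
  fin_cases i <;> simp [Fin.forall_fin_succ] <;> tauto

theorem ext_coord {v w : SupertriangleVertex n} (i : Fin 3) (h : (v.1 i : ℕ) = w.1 i)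
    (h' : (v.1 (i + 1) : ℕ) = w.1 (i + 1)) : v = w := by
  have hv := v.sum_eq i
  have hw := w.sum_eq i
  apply Subtype.ext
  funext m
  apply Fin.ext
  revert m
  rw [forall_coord_iff _ i]
  omega

theorem exists_coord (i : Fin 3) (x y z : ℕ) (h : x + y + z + 1 = n) :
    ∃ v : SupertriangleVertex n,
      (v.1 i : ℕ) = x ∧ (v.1 (i + 1) : ℕ) = y ∧ (v.1 (i + 2) : ℕ) = z := by
  have hx : x < n := by omega
  have hy : y < n := by omega
  have hz : z < n := by omega
  fin_cases i
  · exact ⟨⟨![⟨x, hx⟩, ⟨y, hy⟩, ⟨z, hz⟩], by simpa using h⟩, by simp⟩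
  · exact ⟨⟨![⟨z, hz⟩, ⟨x, hx⟩, ⟨y, hy⟩], by simp; omega⟩, by simp⟩
  · exact ⟨⟨![⟨y, hy⟩, ⟨z, hz⟩, ⟨x, hx⟩], by simp; omega⟩, by simp⟩

end SupertriangleVertex

open SupertriangleVertex

theorem mem_supertriangleSide {n : ℕ} {i : Fin 3} {v : SupertriangleVertex n} :
    v ∈ supertriangleSide n i ↔ (v.1 i : ℕ) = 0 := by
  simp [supertriangleSide]

theorem supertriangle_adj_iff {n : ℕ} {v w : SupertriangleVertex n} (i : Fin 3) :
    (supertriangle n).Adj v w ↔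
      ¬ ((v.1 i : ℕ) = w.1 i ∧ (v.1 (i + 1) : ℕ) = w.1 (i + 1)) ∧
      ((v.1 i : ℕ) ≤ w.1 i + 1 ∧ (w.1 i : ℕ) ≤ v.1 i + 1) ∧
      ((v.1 (i + 1) : ℕ) ≤ w.1 (i + 1) + 1 ∧ (w.1 (i + 1) : ℕ) ≤ v.1 (i + 1) + 1) ∧
      ((v.1 (i + 2) : ℕ) ≤ w.1 (i + 2) + 1 ∧ (w.1 (i + 2) : ℕ) ≤ v.1 (i + 2) + 1) := by
  have h : v ≠ w ↔ ¬ ((v.1 i : ℕ) = w.1 i ∧ (v.1 (i + 1) : ℕ) = w.1 (i + 1)) :=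
    not_congr ⟨by rintro rfl; simp, fun h => ext_coord i h.1 h.2⟩
  rw [← h, ← forall_coord_iff (fun m => (v.1 m : ℕ) ≤ w.1 m + 1 ∧ (w.1 m : ℕ) ≤ v.1 m + 1) i]
  rfl

/-! ### Sizes of the unions of sides -/

theorem card_supertriangleSide (n : ℕ) (i : Fin 3) : (supertriangleSide n i).card = n := by
  refine Eq.trans ?_ (Finset.card_range n)
  refine Finset.card_bij (fun v _ => (v.1 (i + 1) : ℕ)) ?_ ?_ ?_
  · intro v _
    simp
  · intro v hv w hw h
    rw [mem_supertriangleSide] at hv hw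
    exact ext_coord i (by omega) h
  · intro k hk
    rw [Finset.mem_range] at hk
    obtain ⟨v, h0, h1, -⟩ := exists_coord (n := n) i 0 k (n - 1 - k) (by omega)
    exact ⟨v, mem_supertriangleSide.2 h0, h1⟩

theorem card_inter_succ_side {n : ℕ} (hn : 1 ≤ n) (i : Fin 3) :
    (supertriangleSide n i ∩ supertriangleSide n (i + 1)).card = 1 := by
  obtain ⟨v, h0, h1, -⟩ := exists_coord (n := n) i 0 0 (n - 1) (by omega)
  refine Finset.card_eq_one.2 ⟨v, ?_⟩
  ext w
  rw [Finset.mem_inter, mem_supertriangleSide, mem_supertriangleSide, Finset.mem_singleton]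
  constructor
  · rintro ⟨h0', h1'⟩
    exact ext_coord i (by omega) (by omega)
  · rintro rfl
    exact ⟨h0, h1⟩

theorem card_inter_side {n : ℕ} (hn : 1 ≤ n) {i j : Fin 3} (hij : i ≠ j) :
    (supertriangleSide n i ∩ supertriangleSide n j).card = 1 := by
  obtain rfl | rfl : j = i + 1 ∨ i = j + 1 := by revert i j; decide
  · exact card_inter_succ_side hn i
  · rw [Finset.inter_comm]
    exact card_inter_succ_side hn j

theorem card_union_two_sides {n : ℕ} (hn : 1 ≤ n) {i j : Fin 3} (hij : i ≠ j) :
    (supertriangleSide n i ∪ supertriangleSide n j).card = 2 * n - 1 := by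
  rw [Finset.card_union, card_inter_side hn hij, card_supertriangleSide, card_supertriangleSide]
  omega

theorem card_union_three_sides {n : ℕ} (hn : 2 ≤ n) :
    (supertriangleSide n 0 ∪ supertriangleSide n 1 ∪ supertriangleSide n 2).card = 3 * n - 3 := by
  -- A vertex common to all three sides would have coordinate sum `0`, hence `n = 1`.
  have hdisj : Disjoint (supertriangleSide n 0 ∩ supertriangleSide n 2)
      (supertriangleSide n 1 ∩ supertriangleSide n 2) := by
    rw [Finset.disjoint_left]
    intro v hv hw
    simp only [Finset.mem_inter, mem_supertriangleSide] at hv hw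
    have := v.2
    omega
  rw [Finset.card_union, card_union_two_sides (by omega) (by decide), Finset.union_inter_distrib_right,
    Finset.card_union_of_disjoint hdisj, card_inter_side (by omega) (by decide),
    card_inter_side (by omega) (by decide), card_supertriangleSide]
  omega

/-! ### Unions of sides are leaky forcing sets -/

/-- `p` is not in `W` and `x` is its only neighbor in `W`. -/
def IsUniqueNeighborIn {V : Type*} (G : SimpleGraph V) (W : Finset V) (p x : V) : Prop :=
  p ∉ W ∧ x ∈ W ∧ G.Adj p x ∧ ∀ y ∈ W, G.Adj p y → y = x

/-- `p` is the neighbor of `x` obtained by decreasing coordinate `k` by one and increasing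
another coordinate, and `x` is extremal in `W`: if `b`, then coordinate `k + 1` is increased and
coordinate `k` is minimal at `x`; otherwise coordinate `k + 2` is increased and is maximal
at `x`. -/
def IsExtremalStep {n : ℕ} (W : Finset (SupertriangleVertex n)) (k : Fin 3) (b : Bool)
    (p x : SupertriangleVertex n) : Prop :=
  (p.1 k : ℕ) + 1 = x.1 k ∧
    if b then (p.1 (k + 1) : ℕ) = x.1 (k + 1) + 1 ∧ (p.1 (k + 2) : ℕ) = x.1 (k + 2) ∧
      ∀ w ∈ W, (x.1 k : ℕ) ≤ w.1 k
    else (p.1 (k + 1) : ℕ) = x.1 (k + 1) ∧ (p.1 (k + 2) : ℕ) = x.1 (k + 2) + 1 ∧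
      ∀ w ∈ W, (w.1 (k + 2) : ℕ) ≤ x.1 (k + 2)

/-- Integer values allow minimizing a coordinate by maximizing its negative. -/
theorem exists_lex_max {α : Type*} {W : Finset α} (hW : W.Nonempty) (f g : α → ℤ) :
    ∃ x ∈ W, (∀ w ∈ W, f w ≤ f x) ∧ ∀ w ∈ W, f w = f x → g w ≤ g x := by
  obtain ⟨y, hy, hmax⟩ := W.exists_max_image f hW
  obtain ⟨x, hx, hx'⟩ := (W.filter fun w => f w = f y).exists_max_image g ⟨y, by simp [hy]⟩
  simp only [Finset.mem_filter] at hx hx'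
  exact ⟨x, hx.1, fun w hw => hx.2 ▸ hmax w hw, fun w hw h => hx' w ⟨hw, h.trans hx.2⟩⟩

/-- Take the extreme grid line that meets `W`, and let `x` be the last point of `W` at one end of
it. The point `p` lies on the next line outward, which misses `W`, and has only two neighbors on the
extreme line: `x` and a point beyond `x`. As `x` is off side `k`, lowering coordinate `k` stays in
the grid. -/
theorem exists_extremalStep {n : ℕ} {W : Finset (SupertriangleVertex n)} (hW : W.Nonempty)
    {k : Fin 3} (hk : ∀ w ∈ W, (w.1 k : ℕ) ≠ 0) (b : Bool) :
    ∃ p x, IsUniqueNeighborIn (supertriangle n) W p x ∧ IsExtremalStep W k b p x := by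
  cases b
  · obtain ⟨x, hx, hf, hg⟩ := exists_lex_max hW (fun w => ((w.1 (k + 2) : ℕ) : ℤ))
      (fun w => -((w.1 k : ℕ) : ℤ))
    have hs := x.sum_eq k
    have hx0 := hk x hx
    obtain ⟨p, h0, h1, h2⟩ := exists_coord (n := n) k (x.1 k - 1) (x.1 (k + 1)) (x.1 (k + 2) + 1)
      (by omega)
    refine ⟨p, x, ⟨fun hp => ?_, hx, ?_, fun y hy hpy => ?_⟩, ?_⟩
    · have := hf p hp
      omega
    · rw [supertriangle_adj_iff k]
      omega
    · rw [supertriangle_adj_iff k] at hpy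
      have := hf y hy
      have := hg y hy
      have := y.sum_eq k
      exact ext_coord k (by omega) (by omega)
    · refine ⟨by omega, ?_⟩
      simp only [Bool.false_eq_true, if_false]
      exact ⟨h1, h2, fun w hw => by exact_mod_cast hf w hw⟩
  · obtain ⟨x, hx, hf, hg⟩ := exists_lex_max hW (fun w => -((w.1 k : ℕ) : ℤ))
      (fun w => ((w.1 (k + 1) : ℕ) : ℤ))
    have hs := x.sum_eq k
    have hx0 := hk x hx
    obtain ⟨p, h0, h1, h2⟩ := exists_coord (n := n) k (x.1 k - 1) (x.1 (k + 1) + 1) (x.1 (k + 2))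
      (by omega)
    refine ⟨p, x, ⟨fun hp => ?_, hx, ?_, fun y hy hpy => ?_⟩, ?_⟩
    · have := hf p hp
      omega
    · rw [supertriangle_adj_iff k]
      omega
    · rw [supertriangle_adj_iff k] at hpy
      have := hf y hy
      have := hg y hy
      have := y.sum_eq k
      exact ext_coord k (by omega) (by omega)
    · refine ⟨by omega, ?_⟩
      simp only [if_true]
      exact ⟨h1, h2, fun w hw => by have := hf w hw; omega⟩

/-- Extremality puts `W` strictly on one side of a grid line through `p`. Each of `x`, `x'` must
satisfy the strict inequality of the other step, which is impossible for two different pairs. -/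
theorem IsExtremalStep.eq_and_eq {n : ℕ} {W : Finset (SupertriangleVertex n)} {k k' : Fin 3}
    {b b' : Bool} {p x x' : SupertriangleVertex n} (hx : x ∈ W) (hx' : x' ∈ W)
    (h : IsExtremalStep W k b p x) (h' : IsExtremalStep W k' b' p x') : k = k' ∧ b = b' := by
  obtain ⟨h1, h2⟩ := h
  obtain ⟨h1', h2'⟩ := h'
  cases b <;> cases b' <;> simp only [Bool.false_eq_true, if_false, if_true] at h2 h2' <;>
    obtain ⟨h2, h3, h4⟩ := h2 <;> obtain ⟨h2', h3', h4'⟩ := h2' <;>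
    have h5 := h4 x' hx' <;> have h5' := h4' x hx <;> clear h4 h4' <;>
    fin_cases k <;> fin_cases k' <;> simp at * <;> omega

/-- The union of the sides in `S` is a leaky forcing set with fewer than `2 |S|` leaks. -/
theorem isLeakyForcingSet_biUnion_sides (n : ℕ) (S : Finset (Fin 3)) {ℓ : ℕ}
    (hℓ : ℓ < 2 * S.card) :
    IsLeakyForcingSet (supertriangle n) ℓ (S.biUnion (supertriangleSide n)) := by
  classical
  intro L hL v
  by_contra hv
  set B := S.biUnion (supertriangleSide n)
  set W := Finset.univ.filter fun w => ¬ LeakyBlue (supertriangle n) L B w with hWdef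
  have memW : ∀ w, w ∈ W ↔ ¬ LeakyBlue (supertriangle n) L B w := by simp [hWdef]
  have hW : W.Nonempty := ⟨v, (memW v).2 hv⟩
  have hk : ∀ k ∈ S, ∀ w ∈ W, (w.1 k : ℕ) ≠ 0 := fun k hk w hw h0 =>
    (memW w).1 hw (.init (Finset.mem_biUnion.2 ⟨k, hk, mem_supertriangleSide.2 h0⟩))
  have hex : ∀ q : Fin 3 × Bool, ∃ p x, q.1 ∈ S →
      IsUniqueNeighborIn (supertriangle n) W p x ∧ IsExtremalStep W q.1 q.2 p x := by
    intro q
    by_cases hq : q.1 ∈ S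
    · obtain ⟨p, x, h⟩ := exists_extremalStep hW (hk _ hq) q.2
      exact ⟨p, x, fun _ => h⟩
    -- Dummy values, so that `choose` gives total functions.
    · exact ⟨v, v, fun h => absurd h hq⟩
  choose p x hpx using hex
  have hcard : ((S ×ˢ (Finset.univ : Finset Bool)).image p).card = 2 * S.card := by
    rw [Finset.card_image_of_injOn, Finset.card_product, Finset.card_univ, Fintype.card_bool,
      mul_comm]
    intro q hq q' hq' heq
    have hq1 := hpx q (Finset.mem_product.1 hq).1
    have hq2 := hpx q' (Finset.mem_product.1 hq').1
    have := IsExtremalStep.eq_and_eq hq1.1.2.1 hq2.1.2.1 hq1.2 (heq ▸ hq2.2)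
    exact Prod.ext this.1 this.2
  obtain ⟨y, hy, hyL⟩ := Finset.exists_mem_notMem_of_card_lt_card
    (show L.card < ((S ×ˢ (Finset.univ : Finset Bool)).image p).card by omega)
  obtain ⟨q, hq, rfl⟩ := Finset.mem_image.1 hy
  obtain ⟨hpW, hxW, hadj, huniq⟩ := (hpx q (Finset.mem_product.1 hq).1).1
  refine (memW _).1 hxW (.force hyL hadj (by simpa [memW] using hpW) fun z hz hne => ?_)
  by_contra hzW
  exact hne (huniq z ((memW z).2 hzW) hz)

theorem isLeakyForcingSet_side (n : ℕ) (i : Fin 3) :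
    IsLeakyForcingSet (supertriangle n) 1 (supertriangleSide n i) := by
  simpa using isLeakyForcingSet_biUnion_sides n {i} (ℓ := 1) (by simp)

theorem isLeakyForcingSet_two_sides (n : ℕ) {i j : Fin 3} (hij : i ≠ j) :
    IsLeakyForcingSet (supertriangle n) 3 (supertriangleSide n i ∪ supertriangleSide n j) := by
  simpa using isLeakyForcingSet_biUnion_sides n {i, j} (ℓ := 3) (by simp [hij])

theorem isLeakyForcingSet_three_sides (n : ℕ) :
    IsLeakyForcingSet (supertriangle n) 5
      (supertriangleSide n 0 ∪ supertriangleSide n 1 ∪ supertriangleSide n 2) := by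
  have h := isLeakyForcingSet_biUnion_sides n {0, 1, 2} (ℓ := 5) (by decide)
  simpa [Finset.union_assoc] using h

/-! ### Lower bounds -/

/-- A vertex on a side has at most four neighbors, so it is in every `4`-leaky forcing set. -/
theorem supertriangleSide_subset_of_four_leaky {n : ℕ} {B : Finset (SupertriangleVertex n)}
    (hB : IsLeakyForcingSet (supertriangle n) 4 B) (k : Fin 3) : supertriangleSide n k ⊆ B := by
  classical
  intro v hv
  rw [mem_supertriangleSide] at hv
  have hs := v.sum_eq k
  refine hB.mem_of_card_le (Finset.univ.filter fun w => (supertriangle n).Adj v w) (by simp) ?_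
  -- Coordinate `k` is `0` and can only stay or rise by one; these are the displacements left in the
  -- other two coordinates.
  refine (Finset.card_le_card_of_injOn (t := {((0 : ℤ), (-1 : ℤ)), (-1, 0), (1, -1), (-1, 1)})
    (fun w => (((w.1 (k + 1) : ℕ) : ℤ) - (v.1 (k + 1) : ℕ),
      ((w.1 (k + 2) : ℕ) : ℤ) - (v.1 (k + 2) : ℕ))) ?_ ?_).trans Finset.card_le_four
  · intro w hw
    have hw' := (Finset.mem_filter.1 hw).2
    rw [supertriangle_adj_iff k] at hw'
    have := w.sum_eq k
    simp only [Finset.coe_insert, Finset.coe_singleton, Set.mem_insert_iff,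
      Set.mem_singleton_iff, Prod.mk.injEq]
    omega
  · intro w _ w' _ h
    simp only [Prod.mk.injEq] at h
    have := w.sum_eq k
    have := w'.sum_eq k
    exact ext_coord k (by omega) (by omega)

/-- The upward unit triangle whose top vertex, with respect to the third side, is `t`
(if `t` is not on the third side). -/
def upTriangle {n : ℕ} (t : SupertriangleVertex n) : Finset (SupertriangleVertex n) :=
  Finset.univ.filter fun w =>
    (t.1 0 : ℕ) ≤ w.1 0 ∧ (t.1 1 : ℕ) ≤ w.1 1 ∧ (t.1 2 : ℕ) ≤ w.1 2 + 1

/-- Each edge lies in an upward triangle. -/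
theorem exists_upTriangle {n : ℕ} {u w : SupertriangleVertex n}
    (h : (supertriangle n).Adj u w) :
    ∃ t : SupertriangleVertex n, (t.1 2 : ℕ) ≠ 0 ∧ w ∈ upTriangle t ∧
      ∀ x ∈ upTriangle t, x ≠ u → (supertriangle n).Adj u x := by
  rw [supertriangle_adj_iff 0] at h
  simp only [zero_add] at h
  have hu := u.2
  have hw := w.2
  -- For adjacent `u`, `w` the coordinatewise minimum has sum `n - 2`; raising any one coordinate by
  -- one gives a corner of the triangle, and raising the last gives `t`.
  obtain ⟨t, h0, h1, h2⟩ := exists_coord (n := n) 0 (min (u.1 0) (w.1 0) : ℕ)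
    (min (u.1 1) (w.1 1) : ℕ) ((min (u.1 2) (w.1 2) : ℕ) + 1) (by omega)
  simp only [zero_add] at h1 h2
  refine ⟨t, by omega, ?_, fun x hx hxu => ?_⟩
  · simp only [upTriangle, Finset.mem_filter_univ]
    omega
  · simp only [upTriangle, Finset.mem_filter_univ] at hx
    have hxs := x.2
    have hne : ¬ ((u.1 0 : ℕ) = x.1 0 ∧ (u.1 1 : ℕ) = x.1 1) :=
      fun h => hxu (ext_coord 0 h.1 h.2).symm
    rw [supertriangle_adj_iff 0]
    simp only [zero_add]
    omega

/-- A function with zero sum over every upward triangle that vanishes on the initially blue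
vertices vanishes on all vertices that become blue. -/
theorem LeakyBlue.eq_zero {n : ℕ} {L B : Finset (SupertriangleVertex n)}
    {φ : SupertriangleVertex n → ℚ} (hB : ∀ v ∈ B, φ v = 0)
    (hφ : ∀ t : SupertriangleVertex n, (t.1 2 : ℕ) ≠ 0 → ∑ w ∈ upTriangle t, φ w = 0)
    {v : SupertriangleVertex n} (hv : LeakyBlue (supertriangle n) L B v) : φ v = 0 := by
  induction hv with
  | init h => exact hB _ h
  | @force u w _ ha _ _ ihu ih =>
    -- Apart from `w`, the triangle consists of `u` and a neighbor of `u`, where `φ` already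
    -- vanishes.
    obtain ⟨t, ht, hwt, htri⟩ := exists_upTriangle ha
    rw [← hφ t ht]
    refine (Finset.sum_eq_single_of_mem w hwt fun x hx hxw => ?_).symm
    by_cases hxu : x = u
    · exact hxu ▸ ihu
    · exact ih x (htri x hx hxu) hxw

/-- Values on `B` and upward triangle sums determine a function on the vertices. The triangles are
indexed by their top vertices, the vertices off one side, so comparing dimensions gives `|V| ≤ |B| +
(|V| - n)`. -/
theorem le_card_of_isLeakyForcingSet_zero {n : ℕ} {B : Finset (SupertriangleVertex n)}
    (hB : IsLeakyForcingSet (supertriangle n) 0 B) : n ≤ B.card := by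
  classical
  let f : (SupertriangleVertex n → ℚ) →ₗ[ℚ]
      (B → ℚ) × (((supertriangleSide n 2)ᶜ : Finset (SupertriangleVertex n)) → ℚ) :=
    { toFun := fun φ => (fun v => φ v, fun t => ∑ w ∈ upTriangle t.1, φ w)
      map_add' := fun φ ψ => by
        ext <;> simp [Finset.sum_add_distrib]
      map_smul' := fun c φ => by
        ext <;> simp [Finset.mul_sum] }
  have hf : Function.Injective f := by
    rw [injective_iff_map_eq_zero]
    intro φ hφ
    have h1 : ∀ v : B, φ v = 0 := fun v => congrFun (congrArg Prod.fst hφ) v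
    have h2 : ∀ t : ((supertriangleSide n 2)ᶜ : Finset (SupertriangleVertex n)),
        ∑ w ∈ upTriangle t.1, φ w = 0 := fun t => congrFun (congrArg Prod.snd hφ) t
    funext v
    refine (hB ∅ (by simp) v).eq_zero (fun v hv => h1 ⟨v, hv⟩) fun t ht => h2 ⟨t, ?_⟩
    rwa [Finset.mem_compl, mem_supertriangleSide]
  have h := LinearMap.finrank_le_finrank_of_injective hf
  rw [Module.finrank_prod, Module.finrank_fintype_fun_eq_card, Module.finrank_fintype_fun_eq_card,
    Module.finrank_fintype_fun_eq_card, Fintype.card_coe, Fintype.card_coe, Finset.card_compl,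
    card_supertriangleSide] at h
  -- Ensures that the natural subtraction `|V| - n` does not truncate.
  have h' := Finset.card_le_univ (supertriangleSide n 2)
  rw [card_supertriangleSide] at h'
  omega

theorem theorem4p3 (n : ℕ) (hn : 1 ≤ n) :
    (leakyForcingNumber (supertriangle n) 0 = n ∧ leakyForcingNumber (supertriangle n) 1 = n) ∧
    (leakyForcingNumber (supertriangle n) 2 ≤ leakyForcingNumber (supertriangle n) 3 ∧
      leakyForcingNumber (supertriangle n) 3 ≤ 2 * n - 1) ∧
    (2 ≤ n → leakyForcingNumber (supertriangle n) 4 = 3 * n - 3 ∧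
      leakyForcingNumber (supertriangle n) 5 = 3 * n - 3) ∧
    -- sets of these sizes that are leaky forcing sets: one side, two sides, all three sides
    (∀ i : Fin 3, (supertriangleSide n i).card = n ∧
      IsLeakyForcingSet (supertriangle n) 1 (supertriangleSide n i)) ∧
    (∀ i j : Fin 3, i ≠ j →
      (supertriangleSide n i ∪ supertriangleSide n j).card = 2 * n - 1 ∧
      IsLeakyForcingSet (supertriangle n) 3 (supertriangleSide n i ∪ supertriangleSide n j)) ∧
    (2 ≤ n →
      (supertriangleSide n 0 ∪ supertriangleSide n 1 ∪ supertriangleSide n 2).card = 3 * n - 3 ∧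
      IsLeakyForcingSet (supertriangle n) 5
        (supertriangleSide n 0 ∪ supertriangleSide n 1 ∪ supertriangleSide n 2)) := by
  refine ⟨?_, ⟨leakyForcingNumber_mono _ (by norm_num), ?_⟩, fun h2 => ?_,
    fun i => ⟨card_supertriangleSide n i, isLeakyForcingSet_side n i⟩,
    fun i j hij => ⟨card_union_two_sides hn hij, isLeakyForcingSet_two_sides n hij⟩,
    fun h2 => ⟨card_union_three_sides h2, isLeakyForcingSet_three_sides n⟩⟩
  · have hlow : n ≤ leakyForcingNumber (supertriangle n) 0 :=
      le_leakyForcingNumber fun _ => le_card_of_isLeakyForcingSet_zero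
    have hmono := leakyForcingNumber_mono (supertriangle n) (zero_le_one (α := ℕ))
    have hup := leakyForcingNumber_le_card (isLeakyForcingSet_side n 0)
    rw [card_supertriangleSide] at hup
    omega
  · have h01 : (0 : Fin 3) ≠ 1 := by decide
    exact (leakyForcingNumber_le_card (isLeakyForcingSet_two_sides n h01)).trans_eq
      (card_union_two_sides hn h01)
  · have hlow : 3 * n - 3 ≤ leakyForcingNumber (supertriangle n) 4 := by
      refine le_leakyForcingNumber fun B hB => ?_
      rw [← card_union_three_sides h2]
      have hside := supertriangleSide_subset_of_four_leaky hB
      exact Finset.card_le_card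
        (Finset.union_subset (Finset.union_subset (hside 0) (hside 1)) (hside 2))
    have hmono := leakyForcingNumber_mono (supertriangle n) (show 4 ≤ 5 by norm_num)
    have hup := leakyForcingNumber_le_card (isLeakyForcingSet_three_sides n)
    rw [card_union_three_sides h2] at hup
    omega
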